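/- **Completeness of Kalmbach's quantum logic $\mathcal{QL}$ for weakly orthomodular ortholattices.** *Models.* An *ortholattice* is a nonempty algebra $\langle L,{}',\cup,\cap\rangle$ such that for all $a,b,c\in L$: $a\cup b=b\cup a$; $(a\cup b)\cup c=a\cup(b\cup c)$; $a''=a$; $a\cup(b\cup b')=b\cup b'$; $a\cup(a\cap b)=a$; $a\cap b=(a'\cup b')'$. Then $1:=a\cup a'$ does not depend on $a$. Put $a\equiv b:=(a\cap b)\cup(a'\cap b')$. A *weakly orthomodular ortholattice* (WOML) is an ortholattice in which, for all $a,b,c$, $a\equiv b=1$ implies $(a\cup c)\equiv(b\cup c)=1$. *Formulas.* Formulas are built from elementary propositions $p_0,p_1,p_2,\dots$ by $\neg$ and $\vee$. Abbreviate $A\wedge B:=\neg(\neg A\vee\neg B)$, $A\to_0B:=\neg A\vee B$, $A\to_3B:=(\neg A\wedge B)\vee(\neg A\wedge\neg B)\vee(A\wedge(\neg A\vee B))$ and $A\equiv B:=(A\wedge B)\vee(\neg A\wedge\neg B)$. *The logic $\mathcal{QL}$.* Its axioms are all instances of the following schemata: - A1: $A\equiv A$ - A2: $(A\equiv B)\to_0((B\equiv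 C)\to_0(A\equiv C))$ - A3: $(A\equiv B)\to_0(\neg A\equiv\neg B)$ - A4: $(A\equiv B)\to_0((A\wedge C)\equiv(B\wedge C))$ - A5: $(A\wedge B)\equiv(B\wedge A)$ - A6: $(A\wedge(B\wedge C))\equiv((A\wedge B)\wedge C)$ - A7: $(A\wedge(A\vee B))\equiv A$ - A8: $(\neg A\wedge A)\equiv((\neg A\wedge A)\wedge B)$ - A9: $A\equiv\neg\neg A$ - A10: $\neg(A\vee B)\equiv(\neg A\wedge\neg B)$ - A11: $(A\vee(\neg A\wedge(A\vee B)))\equiv(A\vee B)$ - A12: $(A\equiv B)\equiv(B\equiv A)$ - A13: $(A\equiv B)\to_0(A\to_0B)$ - A14: $(A\to_0B)\to_3(A\to_3(A\to_3B))$ - A15: $(A\to_3B)\to_0(A\to_0B)$ Its only rule is modus ponens: from $A$ and $A\to_3B$ infer $B$. For a set $\Gamma$ of formulas, $\Gamma\vdash A$ means that there is a finite sequence of formulas ending with $A$, each of which is an axiom, a member of $\Gamma$, or obtained from two earlier members of the sequence by modus ponens. *Consequence.* A valuation in an ortholattice $L$ is a map $h$ from the set of formulas to $L$ with $h(\neg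 A)=h(A)'$ and $h(A\vee B)=h(A)\cup h(B)$. A formula $A$ is a consequence of $\Gamma$ in $L$ if for every valuation $h$ in $L$: whenever $h(X)=1$ for all $X\in\Gamma$, also $h(A)=1$. **Theorem.** Let $\Gamma$ be a set of formulas and $A$ a formula. If $A$ is a consequence of $\Gamma$ in every WOML, then $\Gamma\vdash A$. -/

import Mathlib

universe u

namespace QuantumLogic

/-! ### Weakly orthomodular ortholattices -/

/-- An ortholattice: a (nonempty) algebra with operations `ᶜ` (orthocomplement), `⊔` (join) and
`⊓` (meet) subject to the six ortholattice equations. -/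
class Ortholattice (L : Type u) extends Compl L, Max L, Min L where
  nonempty : Nonempty L
  sup_comm (a b : L) : a ⊔ b = b ⊔ a
  sup_assoc (a b c : L) : (a ⊔ b) ⊔ c = a ⊔ (b ⊔ c)
  compl_compl (a : L) : aᶜᶜ = a
  sup_sup_compl (a b : L) : a ⊔ (b ⊔ bᶜ) = b ⊔ bᶜ
  sup_inf_self (a b : L) : a ⊔ (a ⊓ b) = a
  inf_def (a b : L) : a ⊓ b = (aᶜ ⊔ bᶜ)ᶜ

namespace Ortholattice

/-- In an ortholattice the element `a ⊔ aᶜ` does not depend on `a`. -/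
theorem sup_compl_const {L : Type u} [Ortholattice L] (a b : L) : a ⊔ aᶜ = b ⊔ bᶜ := by
  rw [← sup_sup_compl (b ⊔ bᶜ) a, sup_comm, sup_sup_compl]

/-- The unit `1` of an ortholattice, i.e. the common value of all the elements `a ⊔ aᶜ`
(see `sup_compl_eq_one`). -/
noncomputable def one (L : Type u) [Ortholattice L] : L :=
  (Classical.choice (nonempty : Nonempty L)) ⊔ (Classical.choice (nonempty : Nonempty L))ᶜ

theorem sup_compl_eq_one {L : Type u} [Ortholattice L] (a : L) : a ⊔ aᶜ = one L :=
  sup_compl_const a _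

/-- The quantum equivalence `a ≡ b` of two elements of an ortholattice. -/
def equiv {L : Type u} [Ortholattice L] (a b : L) : L := (a ⊓ b) ⊔ (aᶜ ⊓ bᶜ)

end Ortholattice

/-- A weakly orthomodular ortholattice (WOML): an ortholattice in which `a ≡ b = 1` implies
`(a ⊔ c) ≡ (b ⊔ c) = 1`. -/
class WOML (L : Type u) extends Ortholattice L where
  weak_orthomodular (a b c : L) :
    Ortholattice.equiv a b = Ortholattice.one L →
      Ortholattice.equiv (a ⊔ c) (b ⊔ c) = Ortholattice.one L

/-! ### Formulas -/

/-- Well-formed formulas, built from the elementary propositions `p 0, p 1, p 2, …` by negation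
and disjunction. -/
inductive Formula : Type
  | p : ℕ → Formula
  | neg : Formula → Formula
  | or : Formula → Formula → Formula

namespace Formula

/-- Conjunction `A ∧ B`. -/
def and (A B : Formula) : Formula := neg (or (neg A) (neg B))

/-- Classical implication `A →₀ B`. -/
def imp0 (A B : Formula) : Formula := or (neg A) B

/-- Kalmbach implication `A →₃ B`, i.e. `(¬A ∧ B) ∨ (¬A ∧ ¬B) ∨ (A ∧ (¬A ∨ B))`. -/
def imp3 (A B : Formula) : Formula :=
  or (or (and (neg A) B) (and (neg A) (neg B))) (and A (or (neg A) B))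

/-- Quantum equivalence `A ≡ B`. -/
def equiv (A B : Formula) : Formula := or (and A B) (and (neg A) (neg B))

end Formula

/-! ### Kalmbach's quantum logic -/

open Formula in
/-- The axioms A1–A15 (schemata) of Kalmbach's quantum logic. -/
inductive QLAxiom : Formula → Prop
  | A1 (A : Formula) : QLAxiom (equiv A A)
  | A2 (A B C : Formula) :
      QLAxiom (imp0 (equiv A B) (imp0 (equiv B C) (equiv A C)))
  | A3 (A B : Formula) : QLAxiom (imp0 (equiv A B) (equiv (neg A) (neg B)))
  | A4 (A B C : Formula) : QLAxiom (imp0 (equiv A B) (equiv (and A C) (and B C)))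
  | A5 (A B : Formula) : QLAxiom (equiv (and A B) (and B A))
  | A6 (A B C : Formula) : QLAxiom (equiv (and A (and B C)) (and (and A B) C))
  | A7 (A B : Formula) : QLAxiom (equiv (and A (or A B)) A)
  | A8 (A B : Formula) : QLAxiom (equiv (and (neg A) A) (and (and (neg A) A) B))
  | A9 (A : Formula) : QLAxiom (equiv A (neg (neg A)))
  | A10 (A B : Formula) : QLAxiom (equiv (neg (or A B)) (and (neg A) (neg B)))
  | A11 (A B : Formula) : QLAxiom (equiv (or A (and (neg A) (or A B))) (or A B))
  | A12 (A B : Formula) : QLAxiom (equiv (equiv A B) (equiv B A))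
  | A13 (A B : Formula) : QLAxiom (imp0 (equiv A B) (imp0 A B))
  | A14 (A B : Formula) : QLAxiom (imp3 (imp0 A B) (imp3 A (imp3 A B)))
  | A15 (A B : Formula) : QLAxiom (imp0 (imp3 A B) (imp0 A B))

/-- `QLDerivable Γ A` means `Γ ⊢ A` in Kalmbach's quantum logic: `A` is obtained from the axioms
and the members of `Γ` by finitely many applications of modus ponens for `→₃`. -/
inductive QLDerivable (Γ : Set Formula) : Formula → Prop
  | ax {A : Formula} : QLAxiom A → QLDerivable Γ A
  | hyp {A : Formula} : A ∈ Γ → QLDerivable Γ A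
  | mp {A B : Formula} :
      QLDerivable Γ A → QLDerivable Γ (Formula.imp3 A B) → QLDerivable Γ B

/-! ### Models -/

/-- A valuation in an ortholattice `L`: a map from formulas to `L` turning `¬`, `∨` into
`ᶜ`, `⊔`. A model is a pair of an algebra `L` and a valuation in it. -/
structure Valuation (L : Type u) [Ortholattice L] where
  toFun : Formula → L
  map_neg (A : Formula) : toFun (Formula.neg A) = (toFun A)ᶜ
  map_or (A B : Formula) : toFun (Formula.or A B) = toFun A ⊔ toFun B

/-- `A` is a consequence of `Γ` in the models with base algebra `L`: every valuation in `L` that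
gives the value `1` to all members of `Γ` gives the value `1` to `A`. -/
def ConsequenceIn (L : Type u) [Ortholattice L] (Γ : Set Formula) (A : Formula) : Prop :=
  ∀ h : Valuation L,
    (∀ X ∈ Γ, h.toFun X = Ortholattice.one L) → h.toFun A = Ortholattice.one L

end QuantumLogic

/-!
The proof is the Lindenbaum–Tarski construction. A14 turns modus ponens for `→₃` into modus ponens
for `→₀`. With it A1, A2, A12 and A13 make `Γ ⊢ A ≡ B` an equivalence relation, and A3 and A4
make it compatible with `¬` and `∧`, hence with `∨` by the De Morgan laws A9 and A10
(`Provable.equiv_trans`, `Provable.equiv_neg`, `Provable.equiv_or`). The axioms A5–A10 then give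
the ortholattice laws in the quotient (`Lindenbaum`).

Provability of `A` and the equation `[A] = 1` coincide (`Lindenbaum.mk_eq_one_iff`): in any
ortholattice `a ≡ 1` equals `a`, so the formulas `A ≡ (p₀ ∨ ¬p₀)` and `A` lie in the same class and
one is provable iff the other is. Consequently `[A] ≡ [B] = 1` forces `[A] = [B]`, that is, the
Lindenbaum algebra is even orthomodular and in particular a WOML. The canonical map `A ↦ [A]` is a
valuation giving `1` exactly to the formulas derivable from `Γ`, and the hypothesis applied to it
is the theorem.
-/

namespace QuantumLogic

open Formula

namespace Ortholattice

variable {L : Type u} [Ortholattice L]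

theorem sup_one (a : L) : a ⊔ one L = one L := by
  rw [← sup_compl_eq_one a, sup_sup_compl]

theorem sup_compl_one (a : L) : a ⊔ (one L)ᶜ = a := by
  have h : a ⊓ aᶜ = (one L)ᶜ := by rw [inf_def, sup_compl_eq_one]
  rw [← h, sup_inf_self]

theorem inf_one (a : L) : a ⊓ one L = a := by
  rw [inf_def, sup_compl_one, compl_compl]

theorem inf_compl_one (a : L) : a ⊓ (one L)ᶜ = (one L)ᶜ := by
  rw [inf_def, compl_compl, sup_one]

/-- Since `a ≡ 1` collapses to `a`, a formula and its equivalence with a tautology have the same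
value in every ortholattice. -/
theorem equiv_one (a : L) : equiv a (one L) = a := by
  rw [equiv, inf_one, inf_compl_one, sup_compl_one]

end Ortholattice

variable {Γ : Set Formula} {A B C D : Formula}

/-- Modus ponens for the classical implication `→₀`: A14 followed by three applications of modus
ponens for `→₃`. -/
theorem QLDerivable.mp_imp0 (hA : QLDerivable Γ A) (h : QLDerivable Γ (imp0 A B)) :
    QLDerivable Γ B :=
  .mp hA (.mp hA (.mp h (.ax (.A14 A B))))

theorem QLDerivable.of_equiv (h : QLDerivable Γ (equiv A B)) (hA : QLDerivable Γ A) :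
    QLDerivable Γ B :=
  hA.mp_imp0 (h.mp_imp0 (.ax (.A13 A B)))

namespace Provable

theorem equiv_symm (h : QLDerivable Γ (equiv A B)) : QLDerivable Γ (equiv B A) :=
  .of_equiv (.ax (.A12 A B)) h

theorem equiv_trans (h : QLDerivable Γ (equiv A B)) (h' : QLDerivable Γ (equiv B C)) :
    QLDerivable Γ (equiv A C) :=
  h'.mp_imp0 (h.mp_imp0 (.ax (.A2 A B C)))

theorem equiv_neg (h : QLDerivable Γ (equiv A B)) : QLDerivable Γ (equiv (neg A) (neg B)) :=
  h.mp_imp0 (.ax (.A3 A B))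

theorem equiv_and (h : QLDerivable Γ (equiv A B)) (h' : QLDerivable Γ (equiv C D)) :
    QLDerivable Γ (equiv (and A C) (and B D)) :=
  equiv_trans (h.mp_imp0 (.ax (.A4 A B C))) <|
    equiv_trans (.ax (.A5 B C)) <|
      equiv_trans (h'.mp_imp0 (.ax (.A4 C D B))) (.ax (.A5 D B))

theorem or_equiv_neg_and (A B : Formula) :
    QLDerivable Γ (equiv (or A B) (neg (and (neg A) (neg B)))) :=
  equiv_trans (.ax (.A9 _)) (equiv_neg (.ax (.A10 A B)))

/-- The De Morgan form of disjunction reduces an equivalence between disjunctions to one between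
conjunctions. -/
theorem or_equiv_or (h : QLDerivable Γ (equiv (and (neg A) (neg B)) (and (neg C) (neg D)))) :
    QLDerivable Γ (equiv (or A B) (or C D)) :=
  equiv_trans (or_equiv_neg_and A B) (equiv_trans (equiv_neg h) (equiv_symm (or_equiv_neg_and C D)))

theorem equiv_or (h : QLDerivable Γ (equiv A B)) (h' : QLDerivable Γ (equiv C D)) :
    QLDerivable Γ (equiv (or A C) (or B D)) :=
  or_equiv_or (equiv_and (equiv_neg h) (equiv_neg h'))

theorem or_comm (A B : Formula) : QLDerivable Γ (equiv (or A B) (or B A)) :=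
  or_equiv_or (.ax (.A5 _ _))

theorem or_assoc (A B C : Formula) :
    QLDerivable Γ (equiv (or (or A B) C) (or A (or B C))) :=
  or_equiv_or <|
    equiv_trans (equiv_and (.ax (.A10 A B)) (.ax (.A1 _))) <|
      equiv_trans (equiv_symm (.ax (.A6 _ _ _))) <|
        equiv_and (.ax (.A1 _)) (equiv_symm (.ax (.A10 B C)))

theorem or_or_neg (A B : Formula) :
    QLDerivable Γ (equiv (or A (or B (neg B))) (or B (neg B))) := by
  -- `¬(B ∨ ¬B)` is equivalent to `¬B ∧ B`, which absorbs every further conjunct by A8.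
  have h : QLDerivable Γ (equiv (neg (or B (neg B))) (and (neg B) B)) :=
    equiv_trans (.ax (.A10 _ _)) (equiv_and (.ax (.A1 _)) (equiv_symm (.ax (.A9 B))))
  have h' : QLDerivable Γ (equiv (and (neg A) (neg (or B (neg B)))) (neg (or B (neg B)))) :=
    equiv_trans (.ax (.A5 _ _)) <|
      equiv_trans (equiv_and h (.ax (.A1 _))) <|
        equiv_trans (equiv_symm (.ax (.A8 B (neg A)))) (equiv_symm h)
  exact equiv_trans (or_equiv_neg_and _ _) (equiv_trans (equiv_neg h') (equiv_symm (.ax (.A9 _))))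

theorem or_and_self (A B : Formula) : QLDerivable Γ (equiv (or A (and A B)) A) := by
  -- `¬(A ∧ B)` unfolds to `¬¬(¬A ∨ ¬B)`, so the claim is the negation of A7 for `¬A` and `¬B`.
  have h : QLDerivable Γ (equiv (and (neg A) (neg (and A B))) (neg A)) :=
    equiv_trans (equiv_and (.ax (.A1 _)) (equiv_symm (.ax (.A9 _)))) (.ax (.A7 (neg A) (neg B)))
  exact equiv_trans (or_equiv_neg_and _ _) (equiv_trans (equiv_neg h) (equiv_symm (.ax (.A9 A))))

theorem or_neg (A : Formula) : QLDerivable Γ (or A (neg A)) :=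
  .of_equiv (or_comm (neg A) A) (.mp_imp0 (.ax (.A1 A)) (.ax (.A13 A A)))

end Provable

/-- Provable equivalence `Γ ⊢ A ≡ B` as a setoid. -/
def provableSetoid (Γ : Set Formula) : Setoid Formula where
  r A B := QLDerivable Γ (equiv A B)
  iseqv := ⟨fun A => .ax (.A1 A), Provable.equiv_symm, Provable.equiv_trans⟩

/-- The Lindenbaum algebra of `Γ`: formulas modulo provable equivalence from `Γ`. Formulas live in
`Type`, and are lifted so that the algebra is available in every universe. -/
def Lindenbaum (Γ : Set Formula) : Type u :=
  Quotient ((provableSetoid Γ).comap (ULift.down : ULift.{u} Formula → Formula))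

namespace Lindenbaum

/-- The class of a formula in the Lindenbaum algebra. -/
def mk (Γ : Set Formula) (A : Formula) : Lindenbaum.{u} Γ :=
  Quotient.mk _ (ULift.up A)

theorem mk_eq_mk_iff : mk.{u} Γ A = mk Γ B ↔ QLDerivable Γ (equiv A B) :=
  Quotient.eq

theorem ind {P : Lindenbaum.{u} Γ → Prop} (h : ∀ A, P (mk Γ A)) (a : Lindenbaum.{u} Γ) : P a :=
  Quotient.ind (fun A => h A.down) a

instance : Compl (Lindenbaum.{u} Γ) where
  compl := Quotient.map (fun A => ⟨neg A.down⟩) fun _ _ h => Provable.equiv_neg h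

instance : Max (Lindenbaum.{u} Γ) where
  max := Quotient.map₂ (fun A B => ⟨or A.down B.down⟩) fun _ _ h _ _ h' => Provable.equiv_or h h'

instance : Min (Lindenbaum.{u} Γ) where
  min a b := (aᶜ ⊔ bᶜ)ᶜ

theorem mk_neg (A : Formula) : mk.{u} Γ (neg A) = (mk Γ A)ᶜ := rfl

theorem mk_or (A B : Formula) : mk.{u} Γ (or A B) = mk Γ A ⊔ mk Γ B := rfl

instance : Ortholattice (Lindenbaum.{u} Γ) where
  nonempty := ⟨mk Γ (p 0)⟩
  sup_comm := ind fun A => ind fun B => mk_eq_mk_iff.2 (Provable.or_comm A B)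
  sup_assoc := ind fun A => ind fun B => ind fun C => mk_eq_mk_iff.2 (Provable.or_assoc A B C)
  compl_compl := ind fun A => mk_eq_mk_iff.2 (Provable.equiv_symm (.ax (.A9 A)))
  sup_sup_compl := ind fun A => ind fun B => mk_eq_mk_iff.2 (Provable.or_or_neg A B)
  sup_inf_self := ind fun A => ind fun B => mk_eq_mk_iff.2 (Provable.or_and_self A B)
  inf_def _ _ := rfl

theorem mk_equiv (A B : Formula) :
    mk.{u} Γ (equiv A B) = Ortholattice.equiv (mk Γ A) (mk Γ B) := rfl

theorem mk_or_neg (A : Formula) : mk.{u} Γ (or A (neg A)) = Ortholattice.one _ :=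
  Ortholattice.sup_compl_eq_one (mk Γ A)

/-- The unit of the Lindenbaum algebra is exactly the class of the formulas derivable from `Γ`. -/
theorem mk_eq_one_iff : mk.{u} Γ A = Ortholattice.one _ ↔ QLDerivable Γ A := by
  rw [← mk_or_neg (p 0), mk_eq_mk_iff]
  refine ⟨fun h => .of_equiv (Provable.equiv_symm h) (Provable.or_neg _), fun h => ?_⟩
  refine .of_equiv (mk_eq_mk_iff.{u}.1 ?_) h
  rw [mk_equiv, mk_or_neg, Ortholattice.equiv_one]

/-- Equivalence with value `1` is equality in the Lindenbaum algebra. -/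
theorem eq_of_equiv_eq_one :
    ∀ a b : Lindenbaum.{u} Γ, Ortholattice.equiv a b = Ortholattice.one _ → a = b :=
  ind fun A => ind fun B h =>
    mk_eq_mk_iff.2 (mk_eq_one_iff.1 ((mk_equiv A B).trans h))

instance : WOML (Lindenbaum.{u} Γ) where
  weak_orthomodular a b c h := by
    rw [eq_of_equiv_eq_one a b h]
    exact ind (P := fun x => Ortholattice.equiv x x = Ortholattice.one _)
      (fun X => (mk_equiv X X).symm.trans (mk_eq_one_iff.2 (.ax (.A1 X)))) (b ⊔ c)

/-- The valuation sending each formula to its class. -/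
def canonicalValuation (Γ : Set Formula) : Valuation (Lindenbaum.{u} Γ) where
  toFun := mk Γ
  map_neg := mk_neg
  map_or := mk_or

end Lindenbaum

end QuantumLogic

theorem mainTheorem1 (Γ : Set QuantumLogic.Formula) (A : QuantumLogic.Formula)
    (hcons : ∀ (L : Type u) [QuantumLogic.WOML L], QuantumLogic.ConsequenceIn L Γ A) :
    QuantumLogic.QLDerivable Γ A :=
  QuantumLogic.Lindenbaum.mk_eq_one_iff.1 <|
    hcons (QuantumLogic.Lindenbaum.{u} Γ) (QuantumLogic.Lindenbaum.canonicalValuation Γ)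
      fun _ hX => QuantumLogic.Lindenbaum.mk_eq_one_iff.2 (.hyp hX)
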